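/- Let $(M,\mathcal F,\mu)$ be a probability space and let $f\colon M\to M$ be an invertible (bimeasurable) measure-preserving transformation. Let $\mathcal F_0\subset\mathcal F$ be a $\sigma$-subalgebra with $f^{-1}\mathcal F_0\subset\mathcal F_0$, and let $\varphi\colon M\to\mathbb R$ be an $L^\infty$ observable with $\int\varphi\,d\mu=0$. Write $\|\cdot\|_p$ for the norm of $L^p(\mu)$, and for $\varepsilon>0$, $n\ge 1$ set $$\mathrm{LD}(\varphi,\varepsilon,n)=\mu\Big(\Big|\frac1n\sum_{j=0}^{n-1}\varphi\circ f^j-\int\varphi\,d\mu\Big|>\varepsilon\Big),\qquad \mathrm{MLD}(\varphi,\varepsilon,n)=\mu\Big(\sup_{k\ge n}\Big|\frac1k\sum_{j=0}^{k-1}\varphi\circ f^j-\int\varphi\,d\mu\Big|>\varepsilon\Big).$$ (a) Suppose that there are constants $C>0$, $\tau>0$ and $0<\omega\le 1$ such that, for all real $p\ge 1$ and all integers $n\ge 1$, $$\|\mathbb E(\varphi\circ f^{-n}\mid\mathcal F_0)\|_p\le C e^{-\frac{\tau}{p}n^\omega}\quad\text{and}\quad \|\mathbb E(\varphi\circ f^{n}\mid\mathcal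 F_0)-\varphi\circ f^n\|_p\le C e^{-\frac{\tau}{p}n^\omega}.$$ Then there exists $\tau'>0$ such that $$\mathrm{LD}(\varphi,\varepsilon,n)\le 2\exp\{-\tau' n^{\omega/2}\varepsilon^\omega\}\quad\text{for all } n\ge 1,\ \varepsilon>0.$$ (b) Suppose that there are constants $C>0$, $\beta>0$ and a real number $p>\max\{2,2\beta\}$ such that, for all integers $n\ge 1$, $$\|\mathbb E(\varphi\circ f^{-n}\mid\mathcal F_0)\|_p\le C n^{-\beta/p}\quad\text{and}\quad \|\mathbb E(\varphi\circ f^{n}\mid\mathcal F_0)-\varphi\circ f^n\|_p\le C n^{-\beta/p}.$$ Then there exists $K>0$ such that $$\mathrm{MLD}(\varphi,\varepsilon,n)\le K\varepsilon^{-p}n^{-\beta}\quad\text{for all } n\ge 1,\ \varepsilon>0.$$ -/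

import Mathlib

open MeasureTheory
open scoped ENNReal

/-- Large deviations of the Birkhoff averages `(1/n) ∑_{j<n} φ ∘ f^j` from the mean of `φ`,
at level `ε` and time `n`. -/
noncomputable def largeDev {M : Type*} [MeasurableSpace M] (μ : Measure M) (f : M → M)
    (φ : M → ℝ) (ε : ℝ) (n : ℕ) : ℝ :=
  μ.real {x | ε < |birkhoffAverage ℝ f φ n x - ∫ y, φ y ∂μ|}

/-- Maximal large deviations: the measure of the set where the supremum over `k ≥ n` of the
deviation at time `k` exceeds `ε`. The supremum is taken in the extended reals, so that it is
correct also at points where the deviations are unbounded in `k`. -/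
noncomputable def maxLargeDev {M : Type*} [MeasurableSpace M] (μ : Measure M) (f : M → M)
    (φ : M → ℝ) (ε : ℝ) (n : ℕ) : ℝ :=
  μ.real {x | (ε : EReal) <
    ⨆ (k : ℕ) (_ : n ≤ k), ((|birkhoffAverage ℝ f φ k x - ∫ y, φ y ∂μ| : ℝ) : EReal)}

/-! ### A second-order inequality for `|x| ^ p` -/

/-! Everything follows from `L^p` bounds on the Birkhoff sums `S_n φ` with explicit dependence on
`p`. Write `G` for the sub-σ-algebra, `H m = E(φ∘f^{-m} | G)` and `R m = E(φ∘f^m | G) - φ∘f^m`, so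
that `φ = H 0 - R 0`. Both `H m - H (m+L)∘f^L` and `R (m+L) - R m∘f^L` have the form `E(g∘f^L | G) -
E(g | G)∘f^L`: they are reverse martingale differences for `f^L`. By 2-smoothness of `L^p`
(`lpNorm_add_sq_le`), the `n`-th Birkhoff sum of such a `D` has norm at most `4√(pnL) ‖D‖_p`
(`lpNorm_birkhoffSum_le_sqrt`).

Doubling `m` repeatedly bounds `‖S_n φ‖_p` by `√(pn) ∑_j 2^{j/2} a(2^j)` plus `n a(2^J)`, up to
constants and a fixed initial term, where `a` is the assumed rate (`lpNorm_birkhoffSum_le_dyadic`).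

For (a), letting `J → ∞` gives `‖S_n φ‖_p ≤ K √n p^{1/ω}` for every `p > 2`; Markov's inequality is
then optimised over `p`. For (b), taking `2^J` comparable to `n` gives `‖S_n φ‖_p ≤ A n^{1-β/p}`. A
chaining argument turns this into a maximal inequality, and summing over dyadic ranges of times `k ≥
n` gives the claim. -/

lemma rpow_sub_rpow_mul_le {a b s : ℝ} (hb : 0 ≤ b) (hba : b ≤ a) (hs : 0 < s) :
    (a ^ s - b ^ s) * b ≤ s * a ^ s * (a - b) := by
  rcases hb.eq_or_lt with rfl | hb'
  · have : 0 ≤ s * a ^ s * (a - 0) := by positivity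
    simpa using this
  have ha : 0 < a := hb'.trans_le hba
  -- After division by `a^s b` the claim is `1 - r^s ≤ s(1/r - 1)` with `r = b/a`; it follows from
  -- `r^s ≥ 1 + s log r` and `log r ≥ 1 - 1/r`. The factor `b` lets this hold for every `s > 0`,
  -- including `s < 1`.
  have h1 : 1 - (b / a)⁻¹ ≤ Real.log (b / a) := Real.one_sub_inv_le_log_of_pos (by positivity)
  have h2 : Real.log (b / a) * s + 1 ≤ (b / a) ^ s := by
    rw [Real.rpow_def_of_pos (by positivity)]; exact Real.add_one_le_exp _
  have h3 : b ^ s = a ^ s * (b / a) ^ s := by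
    rw [← Real.mul_rpow ha.le (by positivity)]; congr 1; field_simp
  have h4 : (1 - a / b) * s + 1 ≤ (b / a) ^ s := by
    rw [inv_div] at h1
    nlinarith
  have h5 : 0 < a ^ s := by positivity
  have h6 : (1 - (b / a) ^ s) * b ≤ s * (a - b) := by
    have : ((1 - a / b) * s + 1) * b ≤ (b / a) ^ s * b := by gcongr
    have e : ((1 - a / b) * s + 1) * b = (b - a) * s + b := by field_simp
    nlinarith
  rw [h3]
  nlinarith

lemma abs_rpow_mul_self_sub_le {u v s : ℝ} (hs : 0 < s) (h : |v| ≤ |u|) :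
    |(|u| ^ s * u - |v| ^ s * v)| ≤ (s + 1) * |u| ^ s * |u - v| := by
  have e : |u| ^ s * u - |v| ^ s * v = |u| ^ s * (u - v) + (|u| ^ s - |v| ^ s) * v := by ring
  have h0 : 0 ≤ |u| ^ s - |v| ^ s := sub_nonneg.2 (by gcongr)
  have h1 := rpow_sub_rpow_mul_le (abs_nonneg v) h hs
  have h2 : |u| - |v| ≤ |u - v| := abs_sub_abs_le_abs_sub u v
  have h3 : 0 ≤ s * |u| ^ s := by positivity
  rw [e]
  refine (abs_add_le _ _).trans ?_
  rw [abs_mul, abs_mul, abs_of_nonneg h0, abs_of_nonneg (by positivity : 0 ≤ |u| ^ s)]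
  nlinarith

/-- Convexity bounds the increment of `|·|^p` by its slope at the endpoint `x + y`; moving that
slope back to `x` costs the quadratic remainder. The linear term must carry the slope at `x`, since
that is what integrates to zero against a martingale difference. -/
lemma abs_add_rpow_le {p : ℝ} (hp : 2 < p) (x y : ℝ) :
    |x + y| ^ p ≤ |x| ^ p + p * (|x| ^ (p - 2) * x * y)
      + p * (p - 1) * (y ^ 2 * (|x| + |y|) ^ (p - 2)) := by
  have hp0 : 0 < p := by linarith
  have hs : 0 < p - 2 := by linarith
  have key : |(|x + y| ^ (p - 2) * (x + y) - |x| ^ (p - 2) * x)|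
      ≤ (p - 1) * (|x| + |y|) ^ (p - 2) * |y| := by
    have hxy := abs_add_le x y
    rcases le_total |x| |x + y| with h | h
    · have := abs_rpow_mul_self_sub_le hs h
      rw [add_sub_cancel_left] at this
      refine this.trans ?_
      have : p - 2 + 1 = p - 1 := by ring
      rw [this]
      gcongr
      linarith
    · have := abs_rpow_mul_self_sub_le hs h
      rw [abs_sub_comm, abs_sub_comm x, add_sub_cancel_left] at this
      refine this.trans ?_
      have : p - 2 + 1 = p - 1 := by ring
      rw [this]
      gcongr
      · linarith
      · linarith [abs_nonneg y]
  set a := x + y with ha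
  -- The tangent line inequality at `a`, obtained from Young's inequality for `|a|^{p-1} |x|`.
  have tangent : |a| ^ p ≤ |x| ^ p + p * (|a| ^ (p - 2) * a * y) := by
    have hq : (p / (p - 1)).HolderConjugate p :=
      (Real.HolderConjugate.conjExponent (by linarith : 1 < p)).symm
    have y1 := Real.young_inequality_of_nonneg (a := |a| ^ (p - 1)) (b := |x|)
      (by positivity) (abs_nonneg x) hq
    rw [← Real.rpow_mul (abs_nonneg a)] at y1
    have e1 : (p - 1) * (p / (p - 1)) = p := by field_simp [show p - 1 ≠ 0 by linarith]
    rw [e1] at y1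
    have e2 : |a| ^ p = |a| ^ (p - 2) * a * a := by
      rw [mul_assoc, ← abs_mul_abs_self a, ← pow_two, ← Real.rpow_two,
        ← Real.rpow_add' (abs_nonneg a) (by linarith)]
      congr 1; ring
    have e3 : |a| ^ (p - 2) * a * x ≤ |a| ^ (p - 1) * |x| := by
      have : |a| ^ (p - 1) = |a| ^ (p - 2) * |a| := by
        rw [← Real.rpow_add_one' (abs_nonneg a) (by linarith)]
        congr 1; ring
      rw [this, mul_assoc, mul_assoc, ← abs_mul]
      gcongr
      exact le_abs_self _
    have e4 : |a| ^ p / (p / (p - 1)) = (p - 1) * |a| ^ p / p := by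
      field_simp [show p - 1 ≠ 0 by linarith]
    rw [e4] at y1
    have y2 : p * (|a| ^ (p - 1) * |x|) ≤ (p - 1) * |a| ^ p + |x| ^ p := by
      have := mul_le_mul_of_nonneg_left y1 hp0.le
      refine this.trans (le_of_eq ?_)
      field_simp
    have e5 : y = a - x := by rw [ha]; ring
    have e6 : |a| ^ (p - 2) * a * y = |a| ^ p - |a| ^ (p - 2) * a * x := by rw [e2, e5]; ring
    rw [e6]
    nlinarith
  have h3 : (|a| ^ (p - 2) * a - |x| ^ (p - 2) * x) * y
      ≤ (p - 1) * (|x| + |y|) ^ (p - 2) * |y| * |y| := by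
    refine (le_abs_self _).trans ?_
    rw [abs_mul]
    gcongr
  have h4 : |y| * |y| = y ^ 2 := by rw [abs_mul_abs_self, pow_two]
  rw [mul_assoc _ |y|, h4] at h3
  nlinarith

/-- Packs the second-order bound into a form that iterates additively in the squares, with a
constant linear in `p`; this linearity yields the factor `√p` in the moment bounds. -/
lemma two_smooth_arith {p a b : ℝ} (hp : 2 < p) (ha : 0 ≤ a) (hb : 0 ≤ b) :
    a ^ p + p * (p - 1) * (b ^ 2 * (a + b) ^ (p - 2)) ≤ (a ^ 2 + 5 * p * b ^ 2) ^ (p / 2) := by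
  have hp0 : 0 < p := by linarith
  rcases hb.eq_or_lt with rfl | hb
  · have : (a ^ 2) ^ (p / 2) = a ^ p := by
      rw [← Real.rpow_two, ← Real.rpow_mul ha]; congr 1; ring
    simp [this]
  -- The weight `p` makes `(a + b)^2 ≤ (1 + 1/p) A`, and `(1 + 1/p)^{(p-2)/2} ≤ e^{1/2} ≤ 2` stays
  -- bounded in `p`.
  set A := a ^ 2 + p * b ^ 2 with hA
  have hA0 : 0 < A := by positivity
  set s := (p - 2) / 2 with hs
  have hs0 : 0 < s := by rw [hs]; linarith
  have h1 : a ^ p ≤ A ^ (p / 2) := by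
    have : a ^ p = (a ^ 2) ^ (p / 2) := by
      rw [← Real.rpow_two, ← Real.rpow_mul ha]; congr 1; ring
    rw [this]
    gcongr
    rw [hA]; nlinarith [sq_nonneg b]
  have h2 : (a + b) ^ 2 ≤ (1 + 1 / p) * A := by
    have e : (1 + 1 / p) * A - (a + b) ^ 2 = (a - p * b) ^ 2 / p := by
      rw [hA]; field_simp; ring
    have : 0 ≤ (a - p * b) ^ 2 / p := by positivity
    linarith
  have h3 : (a + b) ^ (p - 2) ≤ 2 * A ^ s := by
    have e : (a + b) ^ (p - 2) = ((a + b) ^ 2) ^ s := by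
      rw [← Real.rpow_two, ← Real.rpow_mul (by positivity)]; congr 1; rw [hs]; ring
    rw [e]
    calc ((a + b) ^ 2) ^ s ≤ ((1 + 1 / p) * A) ^ s := by gcongr
      _ = (1 + 1 / p) ^ s * A ^ s := by rw [Real.mul_rpow (by positivity) hA0.le]
      _ ≤ 2 * A ^ s := by
        gcongr
        calc (1 + 1 / p) ^ s ≤ (Real.exp (1 / p)) ^ s := by
              gcongr
              linarith [Real.add_one_le_exp (1 / p)]
          _ = Real.exp (1 / p * s) := by rw [← Real.exp_mul]
          _ ≤ Real.exp (1 / 2) := by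
              apply Real.exp_le_exp.2
              rw [hs, one_div_mul_eq_div, div_le_div_iff₀ hp0 (by norm_num)]
              linarith
          _ ≤ 2 := by
              have h := Real.exp_one_lt_d9
              have : Real.exp (1 / 2) ^ 2 = Real.exp 1 := by
                rw [← Real.exp_nat_mul]; norm_num
              nlinarith [Real.exp_pos (1 / 2)]
  have h4 : A ^ (p / 2) + 2 * p ^ 2 * b ^ 2 * A ^ s ≤ (a ^ 2 + 5 * p * b ^ 2) ^ (p / 2) := by
    -- Chosen so that `A (1 + t) = a² + 5pb²`; Bernoulli's inequality with exponent `p/2` then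
    -- produces exactly the term `2p²b² A^s`.
    set t := 4 * p * b ^ 2 / A with ht
    have ht0 : 0 ≤ t := by positivity
    have e1 : a ^ 2 + 5 * p * b ^ 2 = A * (1 + t) := by
      rw [ht, mul_add, mul_div_cancel₀ _ hA0.ne', hA]; ring
    have e2 : A ^ (p / 2) = A ^ s * A := by
      rw [← Real.rpow_add_one hA0.ne']; congr 1; rw [hs]; ring
    have b1 : 1 + p / 2 * t ≤ (1 + t) ^ (p / 2) :=
      one_add_mul_self_le_rpow_one_add (by linarith) (by linarith)
    rw [e1, Real.mul_rpow hA0.le (by positivity), e2]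
    have e3 : A ^ s * A + 2 * p ^ 2 * b ^ 2 * A ^ s = A ^ s * A * (1 + p / 2 * t) := by
      rw [ht]; field_simp; ring
    rw [e3]
    gcongr
  have h5 : p * (p - 1) * (b ^ 2 * (a + b) ^ (p - 2)) ≤ 2 * p ^ 2 * b ^ 2 * A ^ s := by
    calc p * (p - 1) * (b ^ 2 * (a + b) ^ (p - 2)) ≤ p * p * (b ^ 2 * (2 * A ^ s)) := by
          gcongr
          linarith
      _ = _ := by ring
  linarith

/-! ### Moments of sums of martingale differences -/

section Lp

variable {M : Type*} {mM : MeasurableSpace M} {μ : Measure M}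

lemma integral_abs_rpow_eq_lpNorm_rpow {p : ℝ} (hp : 0 < p) {X : M → ℝ}
    (hX : AEStronglyMeasurable X μ) :
    ∫ x, |X x| ^ p ∂μ = lpNorm X (ENNReal.ofReal p) μ ^ p := by
  rw [lpNorm_eq_integral_norm_rpow_toReal (by simpa using hp) ENNReal.ofReal_ne_top hX,
    ENNReal.toReal_ofReal hp.le, ← Real.rpow_mul (integral_nonneg fun x => by positivity),
    inv_mul_cancel₀ hp.ne', Real.rpow_one]
  simp

lemma lpNorm_comp_measurePreserving {p : ℝ≥0∞} {T : M → M} (hT : MeasurePreserving T μ μ)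
    {X : M → ℝ} (hX : AEStronglyMeasurable X μ) : lpNorm (X ∘ T) p μ = lpNorm X p μ := by
  rw [← toReal_eLpNorm hX, ← toReal_eLpNorm (hX.comp_measurePreserving hT),
    eLpNorm_comp_measurePreserving hX hT]

lemma measureReal_lt_abs_le [IsFiniteMeasure μ] {p : ℝ} (hp : 0 < p) {X : M → ℝ}
    (hX : MemLp X (ENNReal.ofReal p) μ) {t : ℝ} (ht : 0 < t) :
    μ.real {x | t < |X x|} ≤ (lpNorm X (ENNReal.ofReal p) μ / t) ^ p := by
  have hint : Integrable (fun x => |X x| ^ p) μ := by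
    have := hX.integrable_norm_rpow (by simpa using hp) ENNReal.ofReal_ne_top
    simpa [ENNReal.toReal_ofReal hp.le] using this
  have h := mul_meas_ge_le_integral_of_nonneg (.of_forall fun x => by positivity) hint (t ^ p)
  rw [integral_abs_rpow_eq_lpNorm_rpow hp hX.1] at h
  rw [Real.div_rpow lpNorm_nonneg ht.le, le_div_iff₀ (by positivity), mul_comm]
  refine le_trans ?_ h
  gcongr with x
  · finiteness
  · intro h
    exact Real.rpow_le_rpow ht.le h.le hp.le

lemma MeasureTheory.MemLp.exists_bound_of_top {X : M → ℝ} (hX : MemLp X ∞ μ) :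
    ∃ C, 0 ≤ C ∧ ∀ᵐ x ∂μ, |X x| ≤ C :=
  ⟨_, lpNorm_nonneg, ae_le_lpNorm_exponent_top hX⟩

lemma lpNorm_le_lpNorm_top [IsProbabilityMeasure μ] {X : M → ℝ} (hX : MemLp X ∞ μ) (p : ℝ≥0∞) :
    lpNorm X p μ ≤ lpNorm X ∞ μ := by
  rw [← toReal_eLpNorm hX.1, ← toReal_eLpNorm hX.1]
  exact ENNReal.toReal_mono hX.eLpNorm_ne_top (eLpNorm_le_eLpNorm_of_exponent_le le_top hX.1)

/-- Hölder with exponents `p/2` and `p/(p-2)`, then Minkowski. -/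
lemma integral_sq_mul_rpow_le [IsFiniteMeasure μ] {p : ℝ} (hp : 2 < p) {X Y : M → ℝ}
    (hX : MemLp X ∞ μ) (hY : MemLp Y ∞ μ) :
    ∫ x, Y x ^ 2 * (|X x| + |Y x|) ^ (p - 2) ∂μ ≤
      lpNorm Y (ENNReal.ofReal p) μ ^ 2 *
        (lpNorm X (ENNReal.ofReal p) μ + lpNorm Y (ENNReal.ofReal p) μ) ^ (p - 2) := by
  have hp0 : 0 < p := by linarith
  have hp2 : p - 2 ≠ 0 := by linarith
  have hpq : (p / 2).HolderConjugate (p / (p - 2)) := by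
    have := Real.HolderConjugate.conjExponent (p := p / 2) (by linarith)
    convert this using 1
    unfold Real.conjExponent
    field_simp
  obtain ⟨A, hA0, hA⟩ := hX.exists_bound_of_top
  obtain ⟨B, hB0, hB⟩ := hY.exists_bound_of_top
  have mX : AEMeasurable X μ := hX.1.aemeasurable
  have mY : AEMeasurable Y μ := hY.1.aemeasurable
  have hZ : MemLp (fun x => |X x| + |Y x|) ∞ μ := by
    simpa [Pi.add_def] using hX.norm.add hY.norm
  have h := integral_mul_le_Lp_mul_Lq_of_nonneg (μ := μ) hpq (f := fun x => Y x ^ 2)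
    (g := fun x => (|X x| + |Y x|) ^ (p - 2)) (.of_forall fun x => by positivity)
    (.of_forall fun x => by positivity)
    (MemLp.mono_exponent (q := ∞) (memLp_top_of_bound (by fun_prop) (B ^ 2) (by
      filter_upwards [hB] with x hx
      rw [Real.norm_eq_abs, abs_pow]
      gcongr)) le_top)
    (MemLp.mono_exponent (q := ∞) (memLp_top_of_bound (by fun_prop (disch := linarith)) ((A + B) ^ (p - 2)) (by
      filter_upwards [hA, hB] with x hx hx'
      rw [Real.norm_eq_abs, abs_of_nonneg (by positivity)]
      gcongr)) le_top)
  have e1 : ∀ x, (Y x ^ 2) ^ (p / 2) = |Y x| ^ p := fun x => by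
    rw [← sq_abs, ← Real.rpow_two, ← Real.rpow_mul (abs_nonneg _)]; congr 1; ring
  have e2 : ∀ x, ((|X x| + |Y x|) ^ (p - 2)) ^ (p / (p - 2)) = |(|X x| + |Y x|)| ^ p := fun x => by
    rw [← Real.rpow_mul (by positivity), abs_of_nonneg (a := |X x| + |Y x|) (by positivity),
      mul_div_cancel₀ _ hp2]
  simp only [e1, e2] at h
  rw [integral_abs_rpow_eq_lpNorm_rpow hp0 hY.1, integral_abs_rpow_eq_lpNorm_rpow hp0 hZ.1,
    ← Real.rpow_mul lpNorm_nonneg, ← Real.rpow_mul lpNorm_nonneg] at h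
  have e3 : p * (1 / (p / 2)) = 2 := by field_simp
  have e4 : p * (1 / (p / (p - 2))) = p - 2 := by field_simp
  rw [e3, e4, Real.rpow_two] at h
  refine h.trans ?_
  gcongr
  · exact lpNorm_nonneg
  · have h1 : (1 : ℝ≥0∞) ≤ ENNReal.ofReal p := by
      rw [← ENNReal.ofReal_one]; exact ENNReal.ofReal_le_ofReal (by linarith)
    have := lpNorm_add_le (μ := μ) (p := ENNReal.ofReal p) (f := fun x => |X x|)
      (g := fun x => |Y x|) ((hX.mono_exponent le_top).norm) h1
    rwa [lpNorm_fun_abs hX.1, lpNorm_fun_abs hY.1] at this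

/-- The space `L^p` is 2-smooth, in the form needed to sum martingale differences. -/
lemma lpNorm_add_sq_le [IsFiniteMeasure μ] {p : ℝ} (hp : 2 < p) {G : MeasurableSpace M}
    (hG : G ≤ mM) {X Y : M → ℝ} (hX : MemLp X ∞ μ) (hY : MemLp Y ∞ μ)
    (hXG : StronglyMeasurable[G] X) (hYG : μ[Y | G] =ᵐ[μ] 0) :
    lpNorm (X + Y) (ENNReal.ofReal p) μ ^ 2 ≤
      lpNorm X (ENNReal.ofReal p) μ ^ 2 + 5 * p * lpNorm Y (ENNReal.ofReal p) μ ^ 2 := by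
  have hp0 : 0 < p := by linarith
  obtain ⟨A, hA0, hA⟩ := hX.exists_bound_of_top
  obtain ⟨B, hB0, hB⟩ := hY.exists_bound_of_top
  have mX : AEMeasurable X μ := hX.1.aemeasurable
  have mY : AEMeasurable Y μ := hY.1.aemeasurable
  have iXp : Integrable (fun x => |X x| ^ p) μ :=
    Integrable.of_bound (by fun_prop (disch := linarith)) (A ^ p) (by
      filter_upwards [hA] with x hx
      rw [Real.norm_eq_abs, abs_of_nonneg (by positivity)]
      gcongr)
  have iXYp : Integrable (fun x => |X x + Y x| ^ p) μ :=
    Integrable.of_bound (by fun_prop (disch := linarith)) ((A + B) ^ p) (by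
      filter_upwards [hA, hB] with x hx hx'
      rw [Real.norm_eq_abs, abs_of_nonneg (by positivity)]
      gcongr
      exact (abs_add_le _ _).trans (by linarith))
  have iψ : Integrable (fun x => |X x| ^ (p - 2) * X x * Y x) μ :=
    Integrable.of_bound (by fun_prop) (A ^ (p - 2) * A * B) (by
      filter_upwards [hA, hB] with x hx hx'
      have : 0 ≤ p - 2 := by linarith
      rw [Real.norm_eq_abs, abs_mul, abs_mul, abs_of_nonneg (by positivity : 0 ≤ |X x| ^ (p - 2))]
      gcongr)
  have iR : Integrable (fun x => Y x ^ 2 * (|X x| + |Y x|) ^ (p - 2)) μ :=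
    Integrable.of_bound (by fun_prop) (B ^ 2 * (A + B) ^ (p - 2)) (by
      filter_upwards [hA, hB] with x hx hx'
      have : 0 ≤ p - 2 := by linarith
      rw [Real.norm_eq_abs, abs_of_nonneg (by positivity), ← sq_abs]
      gcongr)
  -- The slope `|X|^{p-2} X` is `G`-measurable, so it is orthogonal to `Y`.
  have zero : ∫ x, |X x| ^ (p - 2) * X x * Y x ∂μ = 0 := by
    have hm : StronglyMeasurable[G] (fun x => |X x| ^ (p - 2) * X x) := by
      have : Measurable[G] X := hXG.measurable
      exact Measurable.stronglyMeasurable (by fun_prop)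
    have h := condExp_mul_of_stronglyMeasurable_left hm iψ (hY.integrable le_top)
    have h2 := integral_condExp hG (μ := μ) (f := (fun x => |X x| ^ (p - 2) * X x) * Y)
    rw [integral_congr_ae h] at h2
    have h3 : ∫ x, |X x| ^ (p - 2) * X x * Y x ∂μ
      = ∫ x, ((fun x => |X x| ^ (p - 2) * X x) * Y) x ∂μ := rfl
    rw [h3, ← h2]
    refine integral_eq_zero_of_ae ?_
    filter_upwards [hYG] with x hx
    simp [hx]
  set a := lpNorm X (ENNReal.ofReal p) μ
  set b := lpNorm Y (ENNReal.ofReal p) μ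
  have ha : 0 ≤ a := lpNorm_nonneg
  have hb : 0 ≤ b := lpNorm_nonneg
  have main : lpNorm (X + Y) (ENNReal.ofReal p) μ ^ p ≤ (a ^ 2 + 5 * p * b ^ 2) ^ (p / 2) := by
    rw [← integral_abs_rpow_eq_lpNorm_rpow hp0 (hX.add hY).1]
    calc ∫ x, |(X + Y) x| ^ p ∂μ
        ≤ ∫ x, (|X x| ^ p + p * (|X x| ^ (p - 2) * X x * Y x)
          + p * (p - 1) * (Y x ^ 2 * (|X x| + |Y x|) ^ (p - 2))) ∂μ :=
        integral_mono iXYp ((iXp.add (iψ.const_mul p)).add (iR.const_mul _))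
          fun x => abs_add_rpow_le hp _ _
      _ = ∫ x, |X x| ^ p ∂μ
          + p * (p - 1) * ∫ x, Y x ^ 2 * (|X x| + |Y x|) ^ (p - 2) ∂μ := by
        have h1 := integral_add (iXp.add (iψ.const_mul p)) (iR.const_mul (p * (p - 1)))
        have h2 := integral_add iXp (iψ.const_mul p)
        simp only [Pi.add_apply] at h1
        rw [h1, h2, integral_const_mul, integral_const_mul, zero]
        ring
      _ ≤ a ^ p + p * (p - 1) * (b ^ 2 * (a + b) ^ (p - 2)) := by
        rw [integral_abs_rpow_eq_lpNorm_rpow hp0 hX.1]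
        have : 0 ≤ p * (p - 1) := mul_nonneg hp0.le (by linarith)
        gcongr
        exact integral_sq_mul_rpow_le hp hX hY
      _ ≤ _ := two_smooth_arith hp ha hb
  have e : lpNorm (X + Y) (ENNReal.ofReal p) μ ^ p
      = (lpNorm (X + Y) (ENNReal.ofReal p) μ ^ 2) ^ (p / 2) := by
    rw [← Real.rpow_two, ← Real.rpow_mul lpNorm_nonneg]; congr 1; ring
  rw [e] at main
  exact (Real.rpow_le_rpow_iff (by positivity) (by positivity) (by positivity)).1 main

end Lp

/-! ### Birkhoff sums of reverse martingale differences -/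

section Birkhoff

variable {M : Type*} {G mM : MeasurableSpace M} {μ : Measure M}

lemma condExp_comp_measurePreserving [IsFiniteMeasure μ] {T : M → M}
    (hT : MeasurePreserving T μ μ) (hG : G ≤ mM) {g : M → ℝ} (hg : Integrable g μ) :
    μ[g | G] ∘ T =ᵐ[μ] μ[g ∘ T | G.comap T] := by
  have hle : G.comap T ≤ mM := by
    rintro s ⟨t, ht, rfl⟩
    exact hT.measurable (hG t ht)
  have hci : Integrable (μ[g | G] ∘ T) μ := hT.integrable_comp_of_integrable integrable_condExp
  refine ae_eq_condExp_of_forall_setIntegral_eq hle (hT.integrable_comp_of_integrable hg)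
    (fun s _ _ => hci.integrableOn) ?_ ?_
  · rintro s ⟨t, ht, rfl⟩ -
    have key : ∀ u : M → ℝ, Integrable u μ → ∫ x in T ⁻¹' t, (u ∘ T) x ∂μ = ∫ x in t, u x ∂μ := by
      intro u hu
      have h := setIntegral_map (μ := μ) (g := T) (f := u) (hG t ht)
        (by rw [hT.map_eq]; exact hu.1) hT.aemeasurable
      rw [hT.map_eq] at h
      exact h.symm
    rw [key _ integrable_condExp, key _ hg]
    exact setIntegral_condExp hG hg ht
  · exact (stronglyMeasurable_condExp.comp_measurable (comap_measurable T)).aestronglyMeasurable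

lemma memLp_birkhoffSum {T : M → M} (hT : MeasurePreserving T μ μ) {q : ℝ≥0∞}
    {D : M → ℝ} (hD : MemLp D q μ) (n : ℕ) : MemLp (birkhoffSum T D n) q μ := by
  have : birkhoffSum T D n = ∑ i ∈ Finset.range n, D ∘ T^[i] := by
    ext x; simp [birkhoffSum]
  rw [this]
  exact memLp_finsetSum' _ fun i _ => hD.comp_measurePreserving (hT.iterate i)

lemma lpNorm_birkhoffSum_le {T : M → M} (hT : MeasurePreserving T μ μ) {q : ℝ≥0∞} (hq : 1 ≤ q)
    {D : M → ℝ} (hD : MemLp D q μ) (n : ℕ) :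
    lpNorm (birkhoffSum T D n) q μ ≤ n * lpNorm D q μ := by
  have : birkhoffSum T D n = ∑ i ∈ Finset.range n, D ∘ T^[i] := by
    ext x; simp [birkhoffSum]
  rw [this]
  refine (lpNorm_sum_le (fun i _ => hD.comp_measurePreserving (hT.iterate i)) hq).trans ?_
  simp [lpNorm_comp_measurePreserving (hT.iterate _) hD.1]

lemma stronglyMeasurable_birkhoffSum {T : M → M} (hTG : G.comap T ≤ G)
    {D : M → ℝ} (hD : StronglyMeasurable[G] D) (n : ℕ) :
    StronglyMeasurable[G] (birkhoffSum T D n) := by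
  have hT : Measurable[G, G] T := measurable_iff_comap_le.2 hTG
  have : birkhoffSum T D n = ∑ i ∈ Finset.range n, D ∘ T^[i] := by
    ext x; simp [birkhoffSum]
  rw [this]
  exact Finset.stronglyMeasurable_sum _ fun i _ => hD.comp_measurable (hT.iterate i)

/-- Birkhoff sums of a reverse martingale difference. -/
lemma lpNorm_birkhoffSum_sq_le [IsFiniteMeasure μ] {p : ℝ} (hp : 2 < p) {T : M → M}
    (hT : MeasurePreserving T μ μ) (hG : G ≤ mM) (hTG : G.comap T ≤ G)
    {D : M → ℝ} (hD : MemLp D ∞ μ) (hDG : StronglyMeasurable[G] D)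
    (hD0 : μ[D | G.comap T] =ᵐ[μ] 0) (n : ℕ) :
    lpNorm (birkhoffSum T D n) (ENNReal.ofReal p) μ ^ 2 ≤
      5 * p * n * lpNorm D (ENNReal.ofReal p) μ ^ 2 := by
  induction n with
  | zero => simp
  | succ n ih =>
    -- The first summand is peeled off, not the last: the remaining sum factors through `T` and is
    -- measurable for `G.comap T`, on which `D` has zero conditional expectation.
    have e : birkhoffSum T D (n + 1) = birkhoffSum T D n ∘ T + D := by
      ext x; simp [birkhoffSum_succ', add_comm]
    have hS := memLp_birkhoffSum hT hD n
    have h := lpNorm_add_sq_le hp (hTG.trans hG) (hS.comp_measurePreserving hT) hD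
      ((stronglyMeasurable_birkhoffSum hTG hDG n).comp_measurable (comap_measurable T)) hD0
    rw [e]
    refine h.trans ?_
    rw [lpNorm_comp_measurePreserving hT hS.1]
    push_cast
    linarith

lemma birkhoffSum_iterate_comp {T : M → M} (D : M → ℝ) (m n : ℕ) :
    birkhoffSum T (D ∘ T^[m]) n = birkhoffSum T D n ∘ T^[m] := by
  ext x
  simp only [birkhoffSum, Function.comp_apply, ← Function.iterate_add_apply]
  simp_rw [add_comm]

lemma birkhoffSum_mul {T : M → M} (D : M → ℝ) (L n : ℕ) :
    birkhoffSum T D (L * n) = ∑ r ∈ Finset.range L, birkhoffSum T^[L] D n ∘ T^[r] := by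
  induction n with
  | zero => ext x; simp
  | succ n ih =>
    ext x
    rw [mul_add, mul_one, birkhoffSum_add, ih]
    simp only [birkhoffSum_succ, Finset.sum_apply, Function.comp_apply, Finset.sum_add_distrib]
    congr 1
    simp only [birkhoffSum, ← Function.iterate_mul, ← Function.iterate_add_apply]
    simp_rw [add_comm]

/-- Birkhoff sums of an observable `D` which is a reverse martingale difference for `T^L`. -/
lemma lpNorm_birkhoffSum_le_sqrt [IsFiniteMeasure μ] {p : ℝ} (hp : 2 < p) {T : M → M}
    (hT : MeasurePreserving T μ μ) (hG : G ≤ mM) (hTG : G.comap T ≤ G)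
    {D : M → ℝ} (hD : MemLp D ∞ μ) (hDG : StronglyMeasurable[G] D) {L : ℕ} (hL : 0 < L)
    (hD0 : μ[D | G.comap T^[L]] =ᵐ[μ] 0) (n : ℕ) :
    lpNorm (birkhoffSum T D n) (ENNReal.ofReal p) μ ≤
      4 * √(p * n * L) * lpNorm D (ENNReal.ofReal p) μ := by
  have h1p : (1 : ℝ≥0∞) ≤ ENNReal.ofReal p := by
    rw [← ENNReal.ofReal_one]; exact ENNReal.ofReal_le_ofReal (by linarith)
  have hDp : MemLp D (ENNReal.ofReal p) μ := hD.mono_exponent le_top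
  have hTL : MeasurePreserving T^[L] μ μ := hT.iterate L
  have hTGL : G.comap T^[L] ≤ G :=
    measurable_iff_comap_le.1 ((measurable_iff_comap_le.2 hTG).iterate L)
  set d := lpNorm D (ENNReal.ofReal p) μ
  have hd : 0 ≤ d := lpNorm_nonneg
  -- Times below `L * Q` split into `L` residue classes, each a Birkhoff sum of length `Q` for
  -- `T^[L]`. The `s` leftover times are bounded trivially, at no loss since `s ≤ min n L ≤ √(nL)`.
  set Q := n / L
  set s := n % L
  have hn : L * Q + s = n := Nat.div_add_mod n L
  have hsL : s ≤ L := (Nat.mod_lt n hL).le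
  have hsn : s ≤ n := Nat.mod_le n L
  have hQ : lpNorm (birkhoffSum T^[L] D Q) (ENNReal.ofReal p) μ ≤ √(5 * p * Q) * d := by
    have h := lpNorm_birkhoffSum_sq_le hp hTL hG hTGL hD hDG hD0 Q
    rw [← Real.sqrt_sq hd, ← Real.sqrt_mul (by positivity)]
    exact Real.le_sqrt_of_sq_le h
  have e : birkhoffSum T D n = birkhoffSum T D (L * Q) + birkhoffSum T D s ∘ T^[L * Q] := by
    ext x
    rw [← hn, birkhoffSum_add]
    rfl
  have hblock : lpNorm (birkhoffSum T D (L * Q)) (ENNReal.ofReal p) μ ≤ L * (√(5 * p * Q) * d) := by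
    rw [birkhoffSum_mul]
    refine (lpNorm_sum_le (fun r _ =>
      (memLp_birkhoffSum hTL hDp Q).comp_measurePreserving (hT.iterate r)) h1p).trans ?_
    simp only [lpNorm_comp_measurePreserving (hT.iterate _) (memLp_birkhoffSum hTL hDp Q).1,
      Finset.sum_const, Finset.card_range, nsmul_eq_mul]
    gcongr
  have h3 : (L : ℝ) * √(5 * p * Q) ≤ 3 * √(p * n * L) := by
    rw [← Real.sqrt_sq (Nat.cast_nonneg L), ← Real.sqrt_sq (by norm_num : (0 : ℝ) ≤ 3),
      ← Real.sqrt_mul (by positivity), ← Real.sqrt_mul (by positivity)]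
    apply Real.sqrt_le_sqrt
    rw [Real.sqrt_sq (by positivity)]
    have : (L : ℝ) * Q ≤ n := by exact_mod_cast Nat.mul_div_le n L
    have h5 : 0 ≤ p * L := by positivity
    nlinarith
  have h4 : (s : ℝ) ≤ √(p * n * L) := by
    apply Real.le_sqrt_of_sq_le
    have a1 : (s : ℝ) ≤ n := by exact_mod_cast hsn
    have a2 : (s : ℝ) ≤ L := by exact_mod_cast hsL
    calc (s : ℝ) ^ 2 = 1 * s * s := by ring
      _ ≤ p * n * L := by gcongr; linarith
  rw [e]
  refine (lpNorm_add_le (memLp_birkhoffSum hT hDp _) h1p).trans ?_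
  rw [lpNorm_comp_measurePreserving (hT.iterate _) (memLp_birkhoffSum hT hDp s).1]
  have h5 := lpNorm_birkhoffSum_le hT h1p hDp s
  calc _ ≤ L * (√(5 * p * Q) * d) + s * d := add_le_add hblock h5
    _ = L * √(5 * p * Q) * d + s * d := by ring
    _ ≤ 3 * √(p * n * L) * d + √(p * n * L) * d := by gcongr
    _ = _ := by ring

end Birkhoff

/-! ### Dyadic decomposition of an observable along the iterates of a σ-algebra -/

/-- Go from `0` to `1`, then double: the step `L = 2^j` from `2^j` to `2^(j+1)` costs only `√L`. The
crude bound `hN` closes the chain at `2^J`. -/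
lemma dyadic_telescoping_bound {s v : ℕ → ℝ} {K N : ℝ}
    (h : ∀ m L, 0 < L → s m ≤ s (m + L) + K * √L * (v m + v (m + L)))
    (hN : ∀ m, s m ≤ N * v m) (J : ℕ) :
    s 0 ≤ K * (v 0 + v 1 + ∑ j ∈ Finset.range J, √((2 : ℝ) ^ j) * (v (2 ^ j) + v (2 ^ (j + 1))))
      + N * v (2 ^ J) := by
  have key : s 0 ≤ K * (v 0 + v 1
      + ∑ j ∈ Finset.range J, √((2 : ℝ) ^ j) * (v (2 ^ j) + v (2 ^ (j + 1)))) + s (2 ^ J) := by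
    induction J with
    | zero =>
      have := h 0 1 one_pos
      simp only [Nat.cast_one, Real.sqrt_one, zero_add] at this
      simp
      linarith
    | succ J ih =>
      have := h (2 ^ J) (2 ^ J) (by positivity)
      rw [← two_mul, ← pow_succ'] at this
      push_cast at this
      rw [Finset.sum_range_succ]
      linarith
  linarith [hN (2 ^ J)]

section

variable {M : Type*} {G mM : MeasurableSpace M} {μ : Measure M}

/-- Since `E(g | G)∘T^L = E(g∘T^L | T^{-L}G)`, the summand is a difference of conditional
expectations of one function on nested σ-algebras; the tower property kills it on `T^{-L}G`. -/
lemma lpNorm_birkhoffSum_condExp_sub_le [IsFiniteMeasure μ] {p : ℝ} (hp : 2 < p) {T : M → M}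
    (hT : MeasurePreserving T μ μ) (hG : G ≤ mM) (hTG : G.comap T ≤ G)
    {g : M → ℝ} (hg : MemLp g ∞ μ) {L : ℕ} (hL : 0 < L) (n : ℕ) :
    lpNorm (birkhoffSum T (μ[g ∘ T^[L] | G] - μ[g | G] ∘ T^[L]) n) (ENNReal.ofReal p) μ ≤
      4 * √(p * n) * √L *
        lpNorm (μ[g ∘ T^[L] | G] - μ[g | G] ∘ T^[L]) (ENNReal.ofReal p) μ := by
  have hTL : MeasurePreserving T^[L] μ μ := hT.iterate L
  have hTGL : G.comap T^[L] ≤ G :=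
    measurable_iff_comap_le.1 ((measurable_iff_comap_le.2 hTG).iterate L)
  have hgL : MemLp (g ∘ T^[L]) ∞ μ := hg.comp_measurePreserving hTL
  have h1 : MemLp (μ[g ∘ T^[L] | G]) ∞ μ := hgL.condExp le_top
  have h2 : MemLp (μ[g | G] ∘ T^[L]) ∞ μ := (hg.condExp le_top).comp_measurePreserving hTL
  have m2 : StronglyMeasurable[G.comap T^[L]] (μ[g | G] ∘ T^[L]) :=
    stronglyMeasurable_condExp.comp_measurable (comap_measurable _)
  have h0 : μ[μ[g ∘ T^[L] | G] - μ[g | G] ∘ T^[L] | G.comap T^[L]] =ᵐ[μ] 0 := by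
    have e1 := condExp_sub (h1.integrable le_top) (h2.integrable le_top) (G.comap T^[L])
    have e2 := condExp_condExp_of_le (μ := μ) (f := g ∘ T^[L]) hTGL hG
    have e3 := condExp_of_stronglyMeasurable (hTGL.trans hG) m2 (h2.integrable le_top)
    have e4 := condExp_comp_measurePreserving hTL hG (hg.integrable le_top)
    filter_upwards [e1, e2, e4] with x x1 x2 x4
    rw [x1, Pi.sub_apply, x2, e3, x4, sub_self, Pi.zero_apply]
  refine (lpNorm_birkhoffSum_le_sqrt hp hT hG hTG (h1.sub h2)
    (stronglyMeasurable_condExp.sub (m2.mono hTGL)) hL h0 n).trans (le_of_eq ?_)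
  rw [Real.sqrt_mul (by positivity)]
  ring

/-- The dyadic decomposition of Birkhoff sums: if `φ` is well approximated by its conditional
expectations along the past and the conditional expectations along the future are small,
then the `L^p` norms of the Birkhoff sums are controlled. -/
lemma lpNorm_birkhoffSum_le_dyadic [IsProbabilityMeasure μ] {p : ℝ} (hp : 2 < p) (f : M ≃ᵐ M)
    (hf : MeasurePreserving f μ μ) (hG : G ≤ mM) (hfG : G.comap f ≤ G)
    {φ : M → ℝ} (hφ : MemLp φ ∞ μ) {a : ℕ → ℝ}
    (ha1 : ∀ n, 1 ≤ n → lpNorm (μ[φ ∘ f.symm^[n] | G]) (ENNReal.ofReal p) μ ≤ a n)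
    (ha2 : ∀ n, 1 ≤ n → lpNorm (μ[φ ∘ f^[n] | G] - φ ∘ f^[n]) (ENNReal.ofReal p) μ ≤ a n)
    (n J : ℕ) :
    lpNorm (birkhoffSum f φ n) (ENNReal.ofReal p) μ ≤
      8 * √(p * n) * (2 * lpNorm φ ∞ μ + a 1
        + ∑ j ∈ Finset.range J, √((2 : ℝ) ^ j) * (a (2 ^ j) + a (2 ^ (j + 1))))
      + 2 * n * a (2 ^ J) := by
  have h1p : (1 : ℝ≥0∞) ≤ ENNReal.ofReal p := by
    rw [← ENNReal.ofReal_one]; exact ENNReal.ofReal_le_ofReal (by linarith)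
  have hfs : MeasurePreserving f.symm μ μ := hf.symm
  set q := ENNReal.ofReal p
  have mf : ∀ m, MemLp (φ ∘ f^[m]) ∞ μ := fun m => hφ.comp_measurePreserving (hf.iterate m)
  have ms : ∀ m, MemLp (φ ∘ f.symm^[m]) ∞ μ := fun m => hφ.comp_measurePreserving (hfs.iterate m)
  have top : ∀ {g : M → ℝ}, MemLp g ∞ μ → MemLp g q μ := fun h => h.mono_exponent le_top
  let R : ℕ → M → ℝ := fun m => μ[φ ∘ f^[m] | G] - φ ∘ f^[m]
  let H : ℕ → M → ℝ := fun m => μ[φ ∘ f.symm^[m] | G]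
  have mR : ∀ m, MemLp (R m) ∞ μ := fun m => ((mf m).condExp le_top).sub (mf m)
  have mH : ∀ m, MemLp (H m) ∞ μ := fun m => (ms m).condExp le_top
  -- The families `H` and `R` obey the same one-step inequality. The rate is assumed only for `m ≥
  -- 1`, so `v 0` is bounded separately through the sup norm.
  have common : ∀ v : ℕ → M → ℝ, (∀ m, MemLp (v m) ∞ μ) →
      (∀ m, 1 ≤ m → lpNorm (v m) q μ ≤ a m) → lpNorm (v 0) q μ ≤ 2 * lpNorm φ ∞ μ →
      (∀ m L, 0 < L → lpNorm (birkhoffSum f (v m) n) q μ ≤ lpNorm (birkhoffSum f (v (m + L)) n) q μ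
        + 4 * √(p * n) * √L * (lpNorm (v m) q μ + lpNorm (v (m + L)) q μ)) →
      lpNorm (birkhoffSum f (v 0) n) q μ ≤ 4 * √(p * n) * (2 * lpNorm φ ∞ μ + a 1
        + ∑ j ∈ Finset.range J, √((2 : ℝ) ^ j) * (a (2 ^ j) + a (2 ^ (j + 1)))) + n * a (2 ^ J) := by
    intro v mv hv hv0 h
    refine (dyadic_telescoping_bound (s := fun m => lpNorm (birkhoffSum f (v m) n) q μ)
      (v := fun m => lpNorm (v m) q μ) (N := n) h
      (fun m => lpNorm_birkhoffSum_le hf h1p (top (mv m)) n) J).trans ?_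
    have h1 := hv 1 le_rfl
    have h2 := hv (2 ^ J) Nat.one_le_two_pow
    gcongr with j hj
    · exact hv _ Nat.one_le_two_pow
    · exact hv _ Nat.one_le_two_pow
  have hH := common H mH ha1 (by
    refine ((hφ.mono_exponent le_top).lpNorm_condExp_le_lpNorm h1p).trans ?_
    have : lpNorm φ q μ ≤ lpNorm φ ∞ μ := lpNorm_le_lpNorm_top hφ q
    have h0 : 0 ≤ lpNorm φ ∞ μ := lpNorm_nonneg
    linarith) (by
    intro m L hL
    have e : (φ ∘ f.symm^[m + L]) ∘ f^[L] = φ ∘ f.symm^[m] := by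
      have : f.symm^[L] ∘ f^[L] = id :=
        (Function.LeftInverse.iterate f.symm_apply_apply L).comp_eq_id
      rw [Function.iterate_add, Function.comp_assoc, Function.comp_assoc, this, Function.comp_id]
    have h := lpNorm_birkhoffSum_condExp_sub_le hp hf hG hfG (ms (m + L)) hL n
    rw [e] at h
    have e2 : birkhoffSum f (H m) n
        = birkhoffSum f (H m - H (m + L) ∘ f^[L]) n + birkhoffSum f (H (m + L)) n ∘ f^[L] := by
      rw [← birkhoffSum_iterate_comp]
      ext x
      simp [birkhoffSum_sub]
    have mHL := (mH (m + L)).comp_measurePreserving (hf.iterate L)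
    have hD := lpNorm_sub_le (g := H (m + L) ∘ f^[L]) (top (mH m)) h1p
    rw [lpNorm_comp_measurePreserving (hf.iterate L) (mH _).1] at hD
    rw [e2]
    refine (lpNorm_add_le (memLp_birkhoffSum hf (top ((mH m).sub mHL)) n) h1p).trans ?_
    rw [lpNorm_comp_measurePreserving (hf.iterate L) (memLp_birkhoffSum hf (mH _) n).1, add_comm]
    gcongr
    exact h.trans (by gcongr))
  have hR := common R mR ha2 (by
    have h1 := lpNorm_sub_le (μ := μ) (f := μ[φ | G]) (g := φ) (top (hφ.condExp le_top)) h1p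
    have h2 := (hφ.mono_exponent (p := q) le_top).lpNorm_condExp_le_lpNorm (m := G) h1p
    have : lpNorm φ q μ ≤ lpNorm φ ∞ μ := lpNorm_le_lpNorm_top hφ q
    simp only [R, Function.iterate_zero, Function.comp_id]
    linarith) (by
    intro m L hL
    have e : (φ ∘ f^[m]) ∘ f^[L] = φ ∘ f^[m + L] := by
      rw [Function.iterate_add, Function.comp_assoc]
    have h := lpNorm_birkhoffSum_condExp_sub_le hp hf hG hfG (mf m) hL n
    rw [e] at h
    have e3 : μ[φ ∘ f^[m + L] | G] - μ[φ ∘ f^[m] | G] ∘ f^[L] = R (m + L) - R m ∘ f^[L] := by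
      ext x
      simp [R, Function.iterate_add_apply]
    rw [e3] at h
    -- Here the shift falls on `R m`, the term being estimated, whereas for `H` it falls on index `m
    -- + L`; invariance of the norm makes this immaterial.
    have e2 : birkhoffSum f (R m) n ∘ f^[L]
        = birkhoffSum f (R (m + L)) n - birkhoffSum f (R (m + L) - R m ∘ f^[L]) n := by
      rw [← birkhoffSum_iterate_comp]
      ext x
      simp [birkhoffSum_sub]
    have hD := lpNorm_sub_le (g := R m ∘ f^[L]) (top (mR (m + L))) h1p
    rw [lpNorm_comp_measurePreserving (hf.iterate L) (mR _).1] at hD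
    rw [← lpNorm_comp_measurePreserving (hf.iterate L) (memLp_birkhoffSum hf (mR _) n).1, e2]
    refine (lpNorm_sub_le (memLp_birkhoffSum hf (top (mR (m + L))) n) h1p).trans ?_
    gcongr
    refine h.trans ?_
    gcongr
    linarith)
  have e : birkhoffSum f φ n = birkhoffSum f (H 0) n - birkhoffSum f (R 0) n := by
    ext x
    simp [H, R, birkhoffSum_sub]
  rw [e]
  refine (lpNorm_sub_le (memLp_birkhoffSum hf (top (mH 0)) n) h1p).trans ?_
  linarith

end

/-! ### Stretched exponential large deviations -/

lemma rpow_mul_exp_neg_le {s y : ℝ} (hs : 0 < s) (hy : 0 ≤ y) : y ^ s * Real.exp (-y) ≤ s ^ s := by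
  have h1 : y / s ≤ Real.exp (y / s) := by linarith [Real.add_one_le_exp (y / s)]
  have h2 : (y / s) ^ s ≤ Real.exp y := by
    calc (y / s) ^ s ≤ Real.exp (y / s) ^ s := by gcongr
      _ = Real.exp y := by rw [← Real.exp_mul, div_mul_cancel₀ _ hs.ne']
  rw [Real.div_rpow hy hs.le, div_le_iff₀ (by positivity)] at h2
  rw [Real.exp_neg, ← div_eq_mul_inv, div_le_iff₀ (Real.exp_pos _)]
  linarith

/-- With `ψ(x) = x/(1+x)`, the increment `ψ(√2 x) - ψ(x)` is at least `x/(5(1+x)²)`, and the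
exponential absorbs `(1+x)²`. As `0 ≤ ψ ≤ 1`, sums along `x, √2 x, 2x, …` are bounded independently
of the starting point, hence uniformly in `p` below. -/
lemma exists_mul_exp_neg_le_telescoping {τ ω : ℝ} (hτ : 0 < τ) (hω : 0 < ω) :
    ∃ c, 0 < c ∧ ∀ x : ℝ, 0 < x → x * Real.exp (-(τ * (x ^ 2) ^ ω)) ≤
      c * (√2 * x / (1 + √2 * x) - x / (1 + x)) := by
  refine ⟨5 * (2 + 2 * ((1 / ω) ^ (1 / ω) / τ ^ (1 / ω))), by positivity, fun x hx => ?_⟩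
  set B := (1 / ω) ^ (1 / ω) / τ ^ (1 / ω) with hB
  have h1 : x ^ 2 * Real.exp (-(τ * (x ^ 2) ^ ω)) ≤ B := by
    have := rpow_mul_exp_neg_le (s := 1 / ω) (y := τ * (x ^ 2) ^ ω) (by positivity) (by positivity)
    rw [Real.mul_rpow hτ.le (by positivity), ← Real.rpow_mul (by positivity),
      mul_one_div_cancel hω.ne', Real.rpow_one] at this
    rw [hB, le_div_iff₀ (by positivity)]
    linarith
  have h2 : Real.exp (-(τ * (x ^ 2) ^ ω)) ≤ 1 := by
    rw [Real.exp_le_one_iff, neg_nonpos]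
    positivity
  set E := Real.exp (-(τ * (x ^ 2) ^ ω))
  have hE : 0 < E := Real.exp_pos _
  have h3 : (1 + x) ^ 2 * E ≤ 2 + 2 * B := by nlinarith [sq_nonneg (x - 1)]
  have hs1 : (1.4 : ℝ) ≤ √2 := Real.le_sqrt_of_sq_le (by norm_num)
  have hs2 : √2 ≤ 2 := Real.sqrt_le_sqrt (by norm_num : (2 : ℝ) ≤ 4) |>.trans
    (le_of_eq (by rw [show (4 : ℝ) = 2 ^ 2 by norm_num]; exact Real.sqrt_sq (by norm_num)))
  have h4 : √2 * x / (1 + √2 * x) - x / (1 + x) = (√2 - 1) * x / ((1 + √2 * x) * (1 + x)) := by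
    field_simp
    ring
  have h5 : x / (5 * (1 + x) ^ 2) ≤ √2 * x / (1 + √2 * x) - x / (1 + x) := by
    rw [h4, div_le_div_iff₀ (by positivity) (by positivity)]
    have h6 : (1 + √2 * x) ≤ 2 * (1 + x) := by nlinarith
    calc x * ((1 + √2 * x) * (1 + x)) ≤ x * (2 * (1 + x) * (1 + x)) := by gcongr
      _ = 0.4 * x * (5 * (1 + x) ^ 2) := by ring
      _ ≤ (√2 - 1) * x * (5 * (1 + x) ^ 2) := by gcongr; linarith
  calc x * E = x / (5 * (1 + x) ^ 2) * (5 * ((1 + x) ^ 2 * E)) := by field_simp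
    _ ≤ (√2 * x / (1 + √2 * x) - x / (1 + x)) * (5 * (2 + 2 * B)) := by
      have : 0 ≤ x / (5 * (1 + x) ^ 2) := by positivity
      gcongr
      exact this.trans h5
    _ = _ := by ring

lemma exists_sum_sqrt_mul_exp_le {τ ω : ℝ} (hτ : 0 < τ) (hω : 0 < ω) :
    ∃ c, 0 < c ∧ ∀ p : ℝ, 0 < p → ∀ J : ℕ,
      ∑ j ∈ Finset.range J, √((2 : ℝ) ^ j) * Real.exp (-(τ / p) * ((2 : ℝ) ^ j) ^ ω) ≤
        c * p ^ (1 / (2 * ω)) := by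
  obtain ⟨c, hc, h⟩ := exists_mul_exp_neg_le_telescoping hτ hω
  refine ⟨c, hc, fun p hp J => ?_⟩
  -- The scale at which the exponential starts to act: `x j = 2^{j/2}/P` satisfies `(x j ^ 2)^ω =
  -- 2^{jω}/p`.
  set P := p ^ (1 / (2 * ω)) with hP
  have hP0 : 0 < P := by positivity
  let x : ℕ → ℝ := fun j => √((2 : ℝ) ^ j) / P
  have hx : ∀ j, 0 < x j := fun j => by positivity
  have hxs : ∀ j, √2 * x j = x (j + 1) := fun j => by
    simp only [x]
    rw [pow_succ', Real.sqrt_mul (by norm_num)]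
    ring
  have hexp : ∀ j, (x j ^ 2) ^ ω = ((2 : ℝ) ^ j) ^ ω / p := fun j => by
    simp only [x]
    rw [div_pow, Real.sq_sqrt (by positivity), Real.div_rpow (by positivity) (by positivity)]
    congr 1
    rw [hP, ← Real.rpow_natCast, ← Real.rpow_mul hp.le, ← Real.rpow_mul hp.le]
    have : 1 / (2 * ω) * ((2 : ℕ) : ℝ) * ω = 1 := by push_cast; field_simp
    rw [this, Real.rpow_one]
  have term : ∀ j, √((2 : ℝ) ^ j) * Real.exp (-(τ / p) * ((2 : ℝ) ^ j) ^ ω) ≤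
      c * P * (x (j + 1) / (1 + x (j + 1)) - x j / (1 + x j)) := fun j => by
    have := h (x j) (hx j)
    rw [hxs, hexp] at this
    have e : √((2 : ℝ) ^ j) = P * x j := by simp only [x]; field_simp
    have e2 : -(τ / p) * ((2 : ℝ) ^ j) ^ ω = -(τ * (((2 : ℝ) ^ j) ^ ω / p)) := by ring
    rw [e2, e]
    nlinarith
  refine (Finset.sum_le_sum fun j _ => term j).trans ?_
  rw [← Finset.mul_sum, Finset.sum_range_sub (fun j => x j / (1 + x j))]
  have a1 : x J / (1 + x J) ≤ 1 := by
    rw [div_le_one (by linarith [hx J])]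
    linarith
  have a2 : 0 ≤ x 0 / (1 + x 0) := by have := hx 0; positivity
  calc c * P * (x J / (1 + x J) - x 0 / (1 + x 0)) ≤ c * P * 1 := by gcongr; linarith
    _ = c * P := mul_one _

lemma lpNorm_le_of_eLpNorm_le {M : Type*} {mM : MeasurableSpace M} {μ : Measure M} {X : M → ℝ}
    {q : ℝ≥0∞} {c : ℝ} (hc : 0 ≤ c) (h : eLpNorm X q μ ≤ ENNReal.ofReal c) : lpNorm X q μ ≤ c := by
  by_cases hX : AEStronglyMeasurable X μ
  · rw [← toReal_eLpNorm hX]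
    exact ENNReal.toReal_le_of_le_ofReal hc h
  · rwa [lpNorm_of_not_aestronglyMeasurable hX]

section

variable {M : Type*} {G mM : MeasurableSpace M} {μ : Measure M}

lemma exists_lpNorm_birkhoffSum_le_of_exp [IsProbabilityMeasure μ] (f : M ≃ᵐ M)
    (hf : MeasurePreserving f μ μ) (hG : G ≤ mM) (hfG : G.comap f ≤ G)
    {φ : M → ℝ} (hφ : MemLp φ ∞ μ) {C τ ω : ℝ} (hC : 0 < C) (hτ : 0 < τ) (hω : 0 < ω)
    (hω1 : ω ≤ 1)
    (h : ∀ p : ℝ, 1 ≤ p → ∀ n : ℕ, 1 ≤ n →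
      eLpNorm (μ[φ ∘ f.symm^[n] | G]) (ENNReal.ofReal p) μ
          ≤ ENNReal.ofReal (C * Real.exp (-(τ / p) * (n : ℝ) ^ ω)) ∧
      eLpNorm (μ[φ ∘ f^[n] | G] - φ ∘ f^[n]) (ENNReal.ofReal p) μ
          ≤ ENNReal.ofReal (C * Real.exp (-(τ / p) * (n : ℝ) ^ ω))) :
    ∃ K, 0 < K ∧ ∀ p : ℝ, 2 < p → ∀ n : ℕ,
      lpNorm (birkhoffSum f φ n) (ENNReal.ofReal p) μ ≤ K * √n * p ^ (1 / ω) := by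
  obtain ⟨c, hc, hsum⟩ := exists_sum_sqrt_mul_exp_le hτ hω
  set V := lpNorm φ ∞ μ
  have hV : 0 ≤ V := lpNorm_nonneg
  refine ⟨8 * (2 * V + C + 2 * C * c), by positivity, fun p hp n => ?_⟩
  have hp0 : 0 < p := by linarith
  set P := p ^ (1 / (2 * ω)) with hP
  have hP1 : 1 ≤ P := Real.one_le_rpow (by linarith) (by positivity)
  let a : ℕ → ℝ := fun m => C * Real.exp (-(τ / p) * (m : ℝ) ^ ω)
  have ha0 : ∀ m, 0 ≤ a m := fun m => by positivity
  have bound : ∀ J : ℕ, lpNorm (birkhoffSum f φ n) (ENNReal.ofReal p) μ ≤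
      8 * √(p * n) * ((2 * V + C + 2 * C * c) * P) + 2 * n * a (2 ^ J) := fun J => by
    refine (lpNorm_birkhoffSum_le_dyadic hp f hf hG hfG hφ (a := a)
      (fun m hm => lpNorm_le_of_eLpNorm_le (ha0 m) (h p (by linarith) m hm).1)
      (fun m hm => lpNorm_le_of_eLpNorm_le (ha0 m) (h p (by linarith) m hm).2) n J).trans ?_
    gcongr
    have anti : ∀ j : ℕ, a (2 ^ (j + 1)) ≤ a (2 ^ j) := fun j => by
      simp only [a]
      gcongr C * Real.exp ?_
      rw [neg_mul, neg_mul, neg_le_neg_iff]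
      gcongr
      · norm_num
      · omega
    have s1 : ∑ j ∈ Finset.range J, √((2 : ℝ) ^ j) * (a (2 ^ j) + a (2 ^ (j + 1)))
        ≤ 2 * C * (c * P) := by
      calc _ ≤ ∑ j ∈ Finset.range J,
            2 * C * (√((2 : ℝ) ^ j) * Real.exp (-(τ / p) * ((2 : ℝ) ^ j) ^ ω)) := by
            refine Finset.sum_le_sum fun j _ => ?_
            calc _ ≤ √((2 : ℝ) ^ j) * (a (2 ^ j) + a (2 ^ j)) := by gcongr; exact anti j
              _ = _ := by simp only [a]; push_cast; ring
        _ ≤ _ := by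
            rw [← Finset.mul_sum]
            gcongr
            exact hsum p hp0 J
    have s2 : a 1 ≤ C := by
      have : Real.exp (-(τ / p) * ((1 : ℕ) : ℝ) ^ ω) ≤ 1 := by
        rw [Real.exp_le_one_iff, neg_mul, neg_nonpos]; positivity
      simp only [a]
      nlinarith
    nlinarith
  -- The main term is already uniform in `J`, so with `n` fixed the remainder `2 n a(2^J)` can be
  -- sent to zero.
  have lim : Filter.Tendsto (fun J : ℕ => 8 * √(p * n) * ((2 * V + C + 2 * C * c) * P)
      + 2 * n * a (2 ^ J)) Filter.atTop
      (nhds (8 * √(p * n) * ((2 * V + C + 2 * C * c) * P) + 2 * n * (C * 0))) := by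
    refine tendsto_const_nhds.add (Filter.Tendsto.const_mul _ (Filter.Tendsto.const_mul _ ?_))
    refine Real.tendsto_exp_atBot.comp ?_
    refine Filter.Tendsto.const_mul_atTop_of_neg (by simpa using div_pos hτ hp0) ?_
    refine (tendsto_rpow_atTop hω).comp (tendsto_natCast_atTop_atTop.comp ?_)
    exact tendsto_pow_atTop_atTop_of_one_lt (by norm_num)
  have := ge_of_tendsto' lim bound
  rw [mul_zero, mul_zero, add_zero] at this
  refine this.trans ?_
  -- Amounts to `1/2 + 1/(2ω) ≤ 1/ω`, that is, `ω ≤ 1`.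
  have e : √p * P ≤ p ^ (1 / ω) := by
    rw [hP, Real.sqrt_eq_rpow, ← Real.rpow_add hp0]
    apply Real.rpow_le_rpow_of_exponent_le (by linarith)
    rw [div_add_div _ _ two_ne_zero (by positivity), div_le_div_iff₀ (by positivity) hω]
    nlinarith
  rw [Real.sqrt_mul hp0.le]
  calc _ = 8 * (2 * V + C + 2 * C * c) * √n * (√p * P) := by ring
    _ ≤ _ := by gcongr

lemma exists_measureReal_le_exp_of_moments [IsProbabilityMeasure μ] {S : ℕ → M → ℝ}
    (hS : ∀ n, MemLp (S n) ∞ μ) {K ω : ℝ} (hK : 0 < K) (hω : 0 < ω)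
    (h : ∀ p : ℝ, 2 < p → ∀ n : ℕ,
      lpNorm (S n) (ENNReal.ofReal p) μ ≤ K * √n * p ^ (1 / ω)) :
    ∃ τ' : ℝ, 0 < τ' ∧ ∀ n : ℕ, 1 ≤ n → ∀ ε : ℝ, 0 < ε →
      μ.real {x | n * ε < |S n x|} ≤ 2 * Real.exp (-τ' * (n : ℝ) ^ (ω / 2) * ε ^ ω) := by
  refine ⟨(1 / (K * Real.exp 1)) ^ ω / 6, by positivity, fun n hn ε hε => ?_⟩
  have hn0 : (0 : ℝ) < n := by exact_mod_cast hn
  -- Makes the moment bound equal to `nε/e`, so Markov's inequality gives `e^{-p}`. The `1/6` in the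
  -- rate covers `p ≤ 2`, where no moment bound is available: there `2 e^{-p/6} ≥ 2(1 - p/6) ≥ 1`.
  set p := (√n * ε / (K * Real.exp 1)) ^ ω with hp
  have hp0 : 0 < p := by positivity
  have e : -((1 / (K * Real.exp 1)) ^ ω / 6) * (n : ℝ) ^ (ω / 2) * ε ^ ω = -(p / 6) := by
    have : (n : ℝ) ^ (ω / 2) = (√n) ^ ω := by
      rw [Real.sqrt_eq_rpow, ← Real.rpow_mul hn0.le]; congr 1; ring
    rw [this, hp, div_eq_mul_one_div (√n * ε), Real.mul_rpow (by positivity) (by positivity),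
      Real.mul_rpow (by positivity) hε.le]
    ring
  rw [e]
  rcases le_or_gt p 2 with hp2 | hp2
  · refine measureReal_le_one.trans ?_
    have := Real.add_one_le_exp (-(p / 6))
    linarith
  · refine (measureReal_lt_abs_le hp0 ((hS n).mono_exponent le_top) (by positivity)).trans ?_
    have e1 : p ^ (1 / ω) = √n * ε / (K * Real.exp 1) := by
      rw [hp, ← Real.rpow_mul (by positivity), mul_one_div_cancel hω.ne', Real.rpow_one]
    have h1 : lpNorm (S n) (ENNReal.ofReal p) μ / (n * ε) ≤ Real.exp (-1) := by
      rw [div_le_iff₀ (by positivity)]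
      refine (h p hp2 n).trans (le_of_eq ?_)
      rw [e1, Real.exp_neg]
      field_simp
      rw [Real.sq_sqrt hn0.le]
    calc _ ≤ Real.exp (-1) ^ p :=
          Real.rpow_le_rpow (div_nonneg lpNorm_nonneg (by positivity)) h1 hp0.le
      _ = Real.exp (-p) := by rw [← Real.exp_mul]; ring_nf
      _ ≤ 1 * Real.exp (-(p / 6)) := by
          rw [one_mul]; exact Real.exp_le_exp.2 (by linarith)
      _ ≤ _ := by gcongr; norm_num

end

/-! ### Polynomial maximal large deviations -/

/-- Chaining along the binary expansion of `k`: dropping one more low-order digit changes the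
truncation by a single dyadic increment, or not at all. -/
lemma abs_le_sum_of_dyadic_increments {s c : ℕ → ℝ} (h0 : s 0 = 0) (hc : ∀ j, 0 ≤ c j) {N : ℕ}
    (h : ∀ j < N, ∀ i < 2 ^ (N - j), |s (i * 2 ^ j + 2 ^ j) - s (i * 2 ^ j)| ≤ c j)
    {k : ℕ} (hk : k < 2 ^ N) : |s k| ≤ ∑ j ∈ Finset.range N, c j := by
  have key : ∀ m ≤ N, |s k - s (k / 2 ^ m * 2 ^ m)| ≤ ∑ j ∈ Finset.range m, c j := by
    intro m hm
    induction m with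
    | zero => simp
    | succ m ih =>
      have ih := ih (by omega)
      rw [Finset.sum_range_succ]
      set i := k / 2 ^ (m + 1)
      have hdiv : k / 2 ^ m = 2 * i ∨ k / 2 ^ m = 2 * i + 1 := by
        have : i = k / 2 ^ m / 2 := by rw [Nat.div_div_eq_div_mul, ← pow_succ]
        omega
      have e : i * 2 ^ (m + 1) = 2 * i * 2 ^ m := by ring
      rw [e]
      rcases hdiv with hd | hd
      · rw [hd] at ih
        linarith [hc m]
      · have hlt : 2 * i < 2 ^ (N - m) := by
          have h1 : 2 * i * 2 ^ m ≤ k := by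
            rw [← e]; exact Nat.div_mul_le_self _ _
          have h2 : 2 ^ N = 2 ^ (N - m) * 2 ^ m := by
            rw [← pow_add]; congr 1; omega
          rw [h2] at hk
          exact Nat.lt_of_mul_lt_mul_right (h1.trans_lt hk)
        have h3 := h m (by omega) _ hlt
        have e2 : (2 * i + 1) * 2 ^ m = 2 * i * 2 ^ m + 2 ^ m := by ring
        rw [hd, e2] at ih
        have := abs_add_le (s k - s (2 * i * 2 ^ m + 2 ^ m))
          (s (2 * i * 2 ^ m + 2 ^ m) - s (2 * i * 2 ^ m))
        rw [sub_add_sub_cancel] at this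
        linarith
  have := key N le_rfl
  rwa [Nat.div_eq_of_lt hk, zero_mul, h0, sub_zero] at this

section

variable {M : Type*} {G mM : MeasurableSpace M} {μ : Measure M}

lemma exists_lpNorm_birkhoffSum_le_of_rpow [IsProbabilityMeasure μ] (f : M ≃ᵐ M)
    (hf : MeasurePreserving f μ μ) (hG : G ≤ mM) (hfG : G.comap f ≤ G)
    {φ : M → ℝ} (hφ : MemLp φ ∞ μ) {C β p : ℝ} (hC : 0 < C) (hβ : 0 < β) (hp : 2 < p)
    (hpβ : 2 * β < p)
    (h : ∀ n : ℕ, 1 ≤ n →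
      eLpNorm (μ[φ ∘ f.symm^[n] | G]) (ENNReal.ofReal p) μ
          ≤ ENNReal.ofReal (C * (n : ℝ) ^ (-β / p)) ∧
      eLpNorm (μ[φ ∘ f^[n] | G] - φ ∘ f^[n]) (ENNReal.ofReal p) μ
          ≤ ENNReal.ofReal (C * (n : ℝ) ^ (-β / p))) :
    ∃ A, 0 < A ∧ ∀ n : ℕ, 1 ≤ n →
      lpNorm (birkhoffSum f φ n) (ENNReal.ofReal p) μ ≤ A * (n : ℝ) ^ (1 - β / p) := by
  have hp0 : 0 < p := by linarith
  set δ := 1 / 2 - β / p with hδ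
  have hδ0 : 0 < δ := by
    rw [hδ, sub_pos, div_lt_div_iff₀ hp0 two_pos]
    linarith
  set r := (2 : ℝ) ^ δ with hr
  have hr1 : 1 < r := Real.one_lt_rpow one_lt_two hδ0
  have hr1' : 0 < r - 1 := by linarith
  set V := lpNorm φ ∞ μ
  have hV : 0 ≤ V := lpNorm_nonneg
  refine ⟨8 * √p * (2 * V + C + 2 * C / (r - 1)) + 2 * C * 2 ^ (β / p), by positivity,
    fun n hn => ?_⟩
  have hn0 : (0 : ℝ) < n := by exact_mod_cast hn
  have hn1 : (1 : ℝ) ≤ n := by exact_mod_cast hn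
  let a : ℕ → ℝ := fun m => C * (m : ℝ) ^ (-β / p)
  have ha0 : ∀ m, 0 ≤ a m := fun m => by positivity
  -- With `2^J` comparable to `n`, the growing geometric sum is of order `n^{1/2-β/p}`, and both
  -- contributions are of order `n^{1-β/p}`.
  set J := Nat.log 2 n with hJ
  have hJ1 : (2 : ℝ) ^ J ≤ n := by exact_mod_cast Nat.pow_log_le_self 2 (by omega : n ≠ 0)
  have hJ2 : (n : ℝ) ≤ 2 * 2 ^ J := by
    rw [← pow_succ']
    exact_mod_cast (Nat.lt_pow_succ_log_self one_lt_two n).le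
  have hneg : -β / p ≤ 0 := by
    rw [neg_div, neg_nonpos]; positivity
  refine (lpNorm_birkhoffSum_le_dyadic hp f hf hG hfG hφ (a := a)
    (fun m hm => lpNorm_le_of_eLpNorm_le (ha0 m) (h m hm).1)
    (fun m hm => lpNorm_le_of_eLpNorm_le (ha0 m) (h m hm).2) n J).trans ?_
  have anti : ∀ j : ℕ, a (2 ^ (j + 1)) ≤ a (2 ^ j) := fun j => by
    simp only [a]
    refine mul_le_mul_of_nonneg_left ?_ hC.le
    refine Real.rpow_le_rpow_of_nonpos (by positivity) ?_ hneg
    exact_mod_cast Nat.pow_le_pow_right two_pos (by omega)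
  have term : ∀ j : ℕ, √((2 : ℝ) ^ j) * a (2 ^ j) = C * r ^ j := fun j => by
    simp only [a]
    rw [hr, ← Real.rpow_natCast ((2 : ℝ) ^ δ), ← Real.rpow_mul two_pos.le, mul_comm δ,
      Real.rpow_mul two_pos.le, Real.rpow_natCast, Nat.cast_pow, Nat.cast_ofNat,
      Real.sqrt_eq_rpow, mul_left_comm, ← Real.rpow_add (by positivity)]
    congr 2
    rw [hδ]; ring
  have s1 : ∑ j ∈ Finset.range J, √((2 : ℝ) ^ j) * (a (2 ^ j) + a (2 ^ (j + 1)))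
      ≤ 2 * C / (r - 1) * (n : ℝ) ^ δ := by
    calc _ ≤ ∑ j ∈ Finset.range J, 2 * C * r ^ j := by
          refine Finset.sum_le_sum fun j _ => ?_
          calc _ ≤ √((2 : ℝ) ^ j) * (a (2 ^ j) + a (2 ^ j)) := by gcongr; exact anti j
            _ = 2 * C * r ^ j := by rw [← two_mul, mul_left_comm, term]; ring
      _ = 2 * C / (r - 1) * (r ^ J - 1) := by
          rw [← Finset.mul_sum, geom_sum_eq hr1.ne']; ring
      _ ≤ 2 * C / (r - 1) * (n : ℝ) ^ δ := by
          gcongr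
          have : r ^ J = ((2 : ℝ) ^ J) ^ δ := by
            rw [hr, ← Real.rpow_natCast, ← Real.rpow_mul two_pos.le, mul_comm,
              Real.rpow_mul two_pos.le, Real.rpow_natCast]
          rw [this]
          have : ((2 : ℝ) ^ J) ^ δ ≤ (n : ℝ) ^ δ := by gcongr
          linarith
  have s2 : a (2 ^ J) ≤ C * (2 ^ (β / p) * (n : ℝ) ^ (-(β / p))) := by
    simp only [a]
    gcongr
    have h1 : ((2 ^ J : ℕ) : ℝ) ^ (-β / p) ≤ ((n : ℝ) / 2) ^ (-β / p) := by
      refine Real.rpow_le_rpow_of_nonpos (by positivity) ?_ hneg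
      push_cast
      linarith
    refine h1.trans (le_of_eq ?_)
    rw [Real.div_rpow hn0.le two_pos.le, neg_div, Real.rpow_neg two_pos.le, div_inv_eq_mul,
      mul_comm]
  have s3 : a 1 ≤ C := by simp [a]
  have hnδ : 1 ≤ (n : ℝ) ^ δ := Real.one_le_rpow hn1 hδ0.le
  have e1 : √(p * n) * (n : ℝ) ^ δ = √p * (n : ℝ) ^ (1 - β / p) := by
    rw [Real.sqrt_mul hp0.le, mul_assoc, Real.sqrt_eq_rpow n, ← Real.rpow_add hn0]
    congr 2
    rw [hδ]; ring
  have e2 : (n : ℝ) * (n : ℝ) ^ (-(β / p)) = (n : ℝ) ^ (1 - β / p) := by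
    rw [sub_eq_add_neg, Real.rpow_add hn0, Real.rpow_one]
  calc _ ≤ 8 * √(p * n) * ((2 * V + C + 2 * C / (r - 1)) * (n : ℝ) ^ δ)
        + 2 * n * (C * (2 ^ (β / p) * (n : ℝ) ^ (-(β / p)))) := by
        gcongr
        nlinarith
    _ = 8 * (2 * V + C + 2 * C / (r - 1)) * (√(p * n) * (n : ℝ) ^ δ)
        + 2 * C * 2 ^ (β / p) * (n * (n : ℝ) ^ (-(β / p))) := by ring
    _ = _ := by rw [e1, e2]; ring

/-- Chaining, with a union bound over `2^(N-j)` blocks at level `j`. By stationarity all blocks of a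
level have the same norm; `γ p > 1` makes the levels summable, dominated by the longest blocks. -/
lemma exists_measureReal_max_birkhoffSum_le [IsProbabilityMeasure μ] {f : M → M}
    (hf : MeasurePreserving f μ μ) {φ : M → ℝ} (hφ : MemLp φ ∞ μ) {A γ p : ℝ}
    (hA : 0 < A) (hp : 0 < p) (hγ : 1 < γ * p)
    (h : ∀ n : ℕ, 1 ≤ n →
      lpNorm (birkhoffSum f φ n) (ENNReal.ofReal p) μ ≤ A * (n : ℝ) ^ γ) :
    ∃ K, 0 < K ∧ ∀ N : ℕ, ∀ t : ℝ, 0 < t →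
      μ.real {x | ∃ k < 2 ^ N, t < |birkhoffSum f φ k x|} ≤
        K * ((2 : ℝ) ^ N) ^ (γ * p) * t ^ (-p) := by
  set α := γ * p with hα
  set ρ := (2 : ℝ) ^ (-((α - 1) / (2 * p))) with hρ
  have hρ0 : 0 < ρ := by positivity
  have hα1 : 0 < α - 1 := by linarith
  have hρ1 : ρ < 1 := Real.rpow_lt_one_of_one_lt_of_neg one_lt_two
    (by rw [neg_lt_zero]; positivity)
  have hρ1' : 0 < 1 - ρ := by linarith
  set q := (2 : ℝ) ^ (-((α - 1) / 2)) with hq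
  have hq0 : 0 < q := by positivity
  have hq1 : q < 1 := Real.rpow_lt_one_of_one_lt_of_neg one_lt_two
    (by rw [neg_lt_zero]; positivity)
  have hq1' : 0 < 1 - q := by linarith
  refine ⟨2 * A ^ p * (1 - ρ) ^ (-p) / (1 - q), by positivity, fun N t ht => ?_⟩
  -- Splits the threshold `t` over the levels, favouring long blocks. With `i = N-1-j`, Markov's
  -- bound decays like `2^{-(α-1)i} = q^{2i}`; since `ρ^p = q`, the weights spend half of it and
  -- leave `q^i`.
  let c : ℕ → ℝ := fun j => t * ((1 - ρ) * ρ ^ (N - 1 - j))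
  have hc : ∀ j, 0 < c j := fun j => by positivity
  have hcsum : ∑ j ∈ Finset.range N, c j ≤ t := by
    simp only [c]
    rw [← Finset.mul_sum, ← Finset.mul_sum, Finset.sum_range_reflect (fun i => ρ ^ i) N,
      mul_neg_geom_sum]
    have : 0 < ρ ^ N := by positivity
    nlinarith
  have hsub : {x | ∃ k < 2 ^ N, t < |birkhoffSum f φ k x|} ⊆
      ⋃ j ∈ Finset.range N, ⋃ i ∈ Finset.range (2 ^ (N - j)),
        {x | c j < |(birkhoffSum f φ (2 ^ j) ∘ f^[i * 2 ^ j]) x|} := by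
    rintro x ⟨k, hk, hx⟩
    by_contra hcon
    simp only [Set.mem_iUnion, Set.mem_ofPred_eq, not_exists, not_lt, Finset.mem_range] at hcon
    refine absurd hx (not_lt.2 ?_)
    refine (abs_le_sum_of_dyadic_increments (s := fun k => birkhoffSum f φ k x) (by simp)
      (fun j => (hc j).le) ?_ hk).trans hcsum
    intro j hj i hi
    rw [birkhoffSum_add, add_sub_cancel_left]
    exact hcon j hj i hi
  have hpiece : ∀ j i : ℕ, μ.real {x | c j < |(birkhoffSum f φ (2 ^ j) ∘ f^[i * 2 ^ j]) x|} ≤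
      (A * ((2 : ℝ) ^ j) ^ γ / c j) ^ p := by
    intro j i
    have hS := memLp_birkhoffSum hf hφ (2 ^ j)
    refine (measureReal_lt_abs_le hp
      ((hS.comp_measurePreserving (hf.iterate _)).mono_exponent le_top) (hc j)).trans ?_
    rw [lpNorm_comp_measurePreserving (hf.iterate _) hS.1]
    have := h (2 ^ j) Nat.one_le_two_pow
    push_cast at this
    have h0 := hc j
    have h1 : 0 ≤ lpNorm (birkhoffSum f φ (2 ^ j)) (ENNReal.ofReal p) μ := lpNorm_nonneg
    gcongr
  have hterm : ∀ i < N, (2 : ℝ) ^ (N - (N - 1 - i)) *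
      (A * ((2 : ℝ) ^ (N - 1 - i)) ^ γ / c (N - 1 - i)) ^ p ≤
      2 * A ^ p * (1 - ρ) ^ (-p) * (((2 : ℝ) ^ N) ^ α * t ^ (-p)) * q ^ i := by
    intro i hi
    have i1 : N - (N - 1 - i) = i + 1 := by omega
    have i2 : N - 1 - (N - 1 - i) = i := by omega
    simp only [c]
    rw [i1, i2, Real.div_rpow (by positivity) (by positivity),
      Real.mul_rpow hA.le (by positivity), ← Real.rpow_mul (by positivity), ← hα,
      Real.mul_rpow ht.le (by positivity), Real.mul_rpow hρ1'.le (by positivity),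
      Real.rpow_neg hρ1'.le, Real.rpow_neg ht.le]
    have e1 : (ρ ^ i) ^ p = ((2 : ℝ) ^ i) ^ (-((α - 1) / 2)) := by
      rw [hρ, ← Real.rpow_natCast, ← Real.rpow_natCast, ← Real.rpow_mul two_pos.le,
        ← Real.rpow_mul two_pos.le, ← Real.rpow_mul two_pos.le]
      congr 1
      field_simp
    have e2 : q ^ i = ((2 : ℝ) ^ i) ^ (-((α - 1) / 2)) := by
      rw [hq, ← Real.rpow_natCast, ← Real.rpow_natCast, ← Real.rpow_mul two_pos.le,
        ← Real.rpow_mul two_pos.le]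
      congr 1
      ring
    have e3 : ((2 : ℝ) ^ (N - 1 - i)) ^ α * (2 : ℝ) ^ i ≤ ((2 : ℝ) ^ N) ^ α * (q ^ i * q ^ i) := by
      have : q ^ i * q ^ i = ((2 : ℝ) ^ i) ^ (-α) * (2 : ℝ) ^ i := by
        rw [e2, ← Real.rpow_add (by positivity), ← Real.rpow_add_one (by positivity)]
        congr 1; ring
      rw [this, ← mul_assoc, Real.rpow_neg (by positivity), ← div_eq_mul_inv,
        ← Real.div_rpow (by positivity) (by positivity)]
      have : (2 : ℝ) ^ (N - 1 - i) ≤ 2 ^ N / 2 ^ i := by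
        rw [le_div_iff₀ (by positivity), ← pow_add]
        exact pow_le_pow_right₀ one_le_two (by omega)
      gcongr
    rw [e1, ← e2]
    calc _ = 2 * A ^ p * ((1 - ρ) ^ p)⁻¹ * (t ^ p)⁻¹ / q ^ i *
          (((2 : ℝ) ^ (N - 1 - i)) ^ α * 2 ^ i) := by
          rw [pow_succ]
          field_simp
      _ ≤ 2 * A ^ p * ((1 - ρ) ^ p)⁻¹ * (t ^ p)⁻¹ / q ^ i *
          (((2 : ℝ) ^ N) ^ α * (q ^ i * q ^ i)) := by gcongr
      _ = _ := by field_simp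
  calc μ.real {x | ∃ k < 2 ^ N, t < |birkhoffSum f φ k x|}
      ≤ ∑ j ∈ Finset.range N, ∑ i ∈ Finset.range (2 ^ (N - j)),
        μ.real {x | c j < |(birkhoffSum f φ (2 ^ j) ∘ f^[i * 2 ^ j]) x|} := by
        refine (measureReal_mono hsub (measure_ne_top _ _)).trans ?_
        refine (measureReal_biUnion_finset_le _ _).trans ?_
        gcongr
        exact measureReal_biUnion_finset_le _ _
    _ ≤ ∑ j ∈ Finset.range N, (2 : ℝ) ^ (N - j) * (A * ((2 : ℝ) ^ j) ^ γ / c j) ^ p := by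
        refine Finset.sum_le_sum fun j _ => (Finset.sum_le_sum fun i _ => hpiece j i).trans ?_
        simp
    _ = ∑ i ∈ Finset.range N, (2 : ℝ) ^ (N - (N - 1 - i)) *
          (A * ((2 : ℝ) ^ (N - 1 - i)) ^ γ / c (N - 1 - i)) ^ p :=
        (Finset.sum_range_reflect
          (fun j => (2 : ℝ) ^ (N - j) * (A * ((2 : ℝ) ^ j) ^ γ / c j) ^ p) N).symm
    _ ≤ ∑ i ∈ Finset.range N,
          2 * A ^ p * (1 - ρ) ^ (-p) * (((2 : ℝ) ^ N) ^ α * t ^ (-p)) * q ^ i :=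
        Finset.sum_le_sum fun i hi => hterm i (Finset.mem_range.1 hi)
    _ ≤ 2 * A ^ p * (1 - ρ) ^ (-p) * (((2 : ℝ) ^ N) ^ α * t ^ (-p)) * (1 / (1 - q)) := by
        rw [← Finset.mul_sum]
        gcongr
        rw [le_div_iff₀ hq1', geom_sum_mul_neg]
        have : 0 < q ^ N := by positivity
        linarith
    _ = _ := by ring

lemma exists_measureReal_exists_ge_le [IsFiniteMeasure μ] {S : ℕ → M → ℝ} {K β p : ℝ}
    (hK : 0 < K) (hβ : 0 < β)
    (h : ∀ N : ℕ, ∀ t : ℝ, 0 < t →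
      μ.real {x | ∃ k < 2 ^ N, t < |S k x|} ≤ K * ((2 : ℝ) ^ N) ^ (p - β) * t ^ (-p)) :
    ∃ K', 0 < K' ∧ ∀ n : ℕ, 1 ≤ n → ∀ ε : ℝ, 0 < ε →
      μ.real {x | ∃ k ≥ n, k * ε < |S k x|} ≤ K' * ε ^ (-p) * (n : ℝ) ^ (-β) := by
  set q := (2 : ℝ) ^ (-β) with hq
  have hq0 : 0 < q := by positivity
  have hq1 : q < 1 := Real.rpow_lt_one_of_one_lt_of_neg one_lt_two (by linarith)
  have hq1' : 0 < 1 - q := by linarith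
  refine ⟨K * 2 ^ (p - β) * 2 ^ β * (1 - q)⁻¹, by positivity, fun n hn ε hε => ?_⟩
  have hn0 : (0 : ℝ) < n := by exact_mod_cast hn
  set N₀ := Nat.log 2 n
  have hN : (n : ℝ) / 2 ≤ 2 ^ N₀ := by
    rw [div_le_iff₀ two_pos, ← pow_succ]
    exact_mod_cast (Nat.lt_pow_succ_log_self one_lt_two n).le
  -- Covers the times `k` in `[2^(N₀+i), 2^(N₀+i+1))`, where `k ε ≥ 2^(N₀+i) ε`. The maximal
  -- inequality makes these events decay like `2^{-β(N₀+i)}`.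
  let E : ℕ → Set M := fun i => {x | ∃ k < 2 ^ (N₀ + i + 1), 2 ^ (N₀ + i) * ε < |S k x|}
  let b : ℕ → ℝ := fun i => K * 2 ^ (p - β) * 2 ^ β * ε ^ (-p) * (n : ℝ) ^ (-β) * q ^ i
  have hsub : {x | ∃ k ≥ n, k * ε < |S k x|} ⊆ ⋃ i, E i := by
    rintro x ⟨k, hk, hx⟩
    have hle : N₀ ≤ Nat.log 2 k := Nat.log_mono_right hk
    refine Set.mem_iUnion.2 ⟨Nat.log 2 k - N₀, k, ?_, ?_⟩
    · rw [Nat.add_sub_cancel' hle]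
      exact Nat.lt_pow_succ_log_self one_lt_two k
    · rw [Nat.add_sub_cancel' hle]
      refine lt_of_le_of_lt ?_ hx
      gcongr
      exact_mod_cast Nat.pow_log_le_self 2 (by omega : k ≠ 0)
  have hE : ∀ i, μ.real (E i) ≤ b i := by
    intro i
    refine (h (N₀ + i + 1) (2 ^ (N₀ + i) * ε) (by positivity)).trans ?_
    have e1 : ((2 : ℝ) ^ (N₀ + i + 1)) ^ (p - β) * ((2 : ℝ) ^ (N₀ + i)) ^ (-p)
        = 2 ^ (p - β) * (((2 : ℝ) ^ N₀) ^ (-β) * q ^ i) := by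
      have : q ^ i = ((2 : ℝ) ^ i) ^ (-β) := by
        rw [hq, ← Real.rpow_natCast, ← Real.rpow_natCast, ← Real.rpow_mul two_pos.le,
          ← Real.rpow_mul two_pos.le, mul_comm]
      rw [this, ← Real.mul_rpow (by positivity) (by positivity), ← pow_add, pow_succ',
        Real.mul_rpow two_pos.le (by positivity), mul_assoc, ← Real.rpow_add (by positivity)]
      congr 2
      ring
    have e2 : ((2 : ℝ) ^ N₀) ^ (-β) ≤ 2 ^ β * (n : ℝ) ^ (-β) := by
      refine (Real.rpow_le_rpow_of_nonpos (by positivity) hN (by linarith)).trans (le_of_eq ?_)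
      rw [Real.div_rpow hn0.le two_pos.le, Real.rpow_neg two_pos.le, div_inv_eq_mul, mul_comm]
    rw [Real.mul_rpow (by positivity) hε.le]
    calc _ = K * ε ^ (-p) *
          (((2 : ℝ) ^ (N₀ + i + 1)) ^ (p - β) * ((2 : ℝ) ^ (N₀ + i)) ^ (-p)) := by ring
      _ = K * ε ^ (-p) * (2 ^ (p - β) * (((2 : ℝ) ^ N₀) ^ (-β) * q ^ i)) := by rw [e1]
      _ ≤ K * ε ^ (-p) * (2 ^ (p - β) * ((2 ^ β * (n : ℝ) ^ (-β)) * q ^ i)) := by gcongr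
      _ = b i := by simp only [b]; ring
  have hb : HasSum b (K * 2 ^ (p - β) * 2 ^ β * ε ^ (-p) * (n : ℝ) ^ (-β) * (1 - q)⁻¹) :=
    (hasSum_geometric_of_lt_one hq0.le hq1).mul_left _
  have hb0 : ∀ i, 0 ≤ b i := fun i => by positivity
  have : μ {x | ∃ k ≥ n, k * ε < |S k x|} ≤ ENNReal.ofReal (∑' i, b i) := by
    rw [ENNReal.ofReal_tsum_of_nonneg hb0 hb.summable]
    refine (measure_mono hsub).trans ((measure_iUnion_le E).trans ?_)
    exact ENNReal.tsum_le_tsum fun i =>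
      (ENNReal.le_ofReal_iff_toReal_le (by finiteness) (hb0 i)).2 (hE i)
  refine (ENNReal.toReal_le_of_le_ofReal (tsum_nonneg hb0) this).trans (le_of_eq ?_)
  rw [hb.tsum_eq]
  ring

end

/-! ### From Birkhoff sums to averages, and the theorem -/

lemma abs_birkhoffAverage_gt_iff {M : Type*} {f : M → M} {φ : M → ℝ} {n : ℕ} (hn : 1 ≤ n) {ε : ℝ}
    {x : M} : ε < |birkhoffAverage ℝ f φ n x| ↔ n * ε < |birkhoffSum f φ n x| := by
  have hn0 : (0 : ℝ) < n := by exact_mod_cast hn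
  rw [birkhoffAverage, smul_eq_mul, abs_mul, abs_of_pos (inv_pos.2 hn0), inv_mul_eq_div,
    lt_div_iff₀ hn0, mul_comm]

theorem theorem3p1 {M : Type*} {m₀ mM : MeasurableSpace M}
    (μ : Measure M) [IsProbabilityMeasure μ]
    (f : M ≃ᵐ M) (hf : MeasurePreserving f μ μ)
    (hm₀ : m₀ ≤ mM) (hfm₀ : MeasurableSpace.comap f m₀ ≤ m₀)
    (φ : M → ℝ) (hφ : MemLp φ ∞ μ) (hφ_mean : ∫ x, φ x ∂μ = 0) :
    -- (a) the (stretched) exponential case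
    (∀ C τ ω : ℝ, 0 < C → 0 < τ → 0 < ω → ω ≤ 1 →
      (∀ p : ℝ, 1 ≤ p → ∀ n : ℕ, 1 ≤ n →
        eLpNorm (μ[φ ∘ f.symm^[n] | m₀]) (ENNReal.ofReal p) μ
            ≤ ENNReal.ofReal (C * Real.exp (-(τ / p) * (n : ℝ) ^ ω)) ∧
        eLpNorm (μ[φ ∘ f^[n] | m₀] - φ ∘ f^[n]) (ENNReal.ofReal p) μ
            ≤ ENNReal.ofReal (C * Real.exp (-(τ / p) * (n : ℝ) ^ ω))) →
      ∃ τ' : ℝ, 0 < τ' ∧ ∀ n : ℕ, 1 ≤ n → ∀ ε : ℝ, 0 < ε →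
        largeDev μ f φ ε n ≤ 2 * Real.exp (-τ' * (n : ℝ) ^ (ω / 2) * ε ^ ω)) ∧
    -- (b) the polynomial case
    (∀ C β p : ℝ, 0 < C → 0 < β → max 2 (2 * β) < p →
      (∀ n : ℕ, 1 ≤ n →
        eLpNorm (μ[φ ∘ f.symm^[n] | m₀]) (ENNReal.ofReal p) μ
            ≤ ENNReal.ofReal (C * (n : ℝ) ^ (-β / p)) ∧
        eLpNorm (μ[φ ∘ f^[n] | m₀] - φ ∘ f^[n]) (ENNReal.ofReal p) μ
            ≤ ENNReal.ofReal (C * (n : ℝ) ^ (-β / p))) →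
      ∃ K : ℝ, 0 < K ∧ ∀ n : ℕ, 1 ≤ n → ∀ ε : ℝ, 0 < ε →
        maxLargeDev μ f φ ε n ≤ K * ε ^ (-p) * (n : ℝ) ^ (-β)) := by
  refine ⟨fun C τ ω hC hτ hω hω1 h => ?_, fun C β p hC hβ hp h => ?_⟩
  · obtain ⟨K, hK, hmom⟩ :=
      exists_lpNorm_birkhoffSum_le_of_exp f hf hm₀ hfm₀ hφ hC hτ hω hω1 h
    obtain ⟨τ', hτ', hLD⟩ := exists_measureReal_le_exp_of_moments
      (fun n => memLp_birkhoffSum hf hφ n) hK hω hmom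
    refine ⟨τ', hτ', fun n hn ε hε => ?_⟩
    simpa only [largeDev, hφ_mean, sub_zero, abs_birkhoffAverage_gt_iff hn] using hLD n hn ε hε
  · obtain ⟨hp2, hpβ⟩ := max_lt_iff.1 hp
    have hp0 : 0 < p := by linarith
    obtain ⟨A, hA, hmom⟩ := exists_lpNorm_birkhoffSum_le_of_rpow f hf hm₀ hfm₀ hφ hC hβ hp2 hpβ h
    have e : (1 - β / p) * p = p - β := by field_simp
    -- The summability condition reads `p - β > 1`, which follows from `β < p/2` and `p > 2`.
    obtain ⟨K₁, hK₁, hmax⟩ := exists_measureReal_max_birkhoffSum_le hf hφ hA hp0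
      (by rw [e]; linarith) hmom
    rw [e] at hmax
    obtain ⟨K, hK, hMLD⟩ := exists_measureReal_exists_ge_le hK₁ hβ hmax
    refine ⟨K, hK, fun n hn ε hε => ?_⟩
    convert hMLD n hn ε hε using 2
    rw [maxLargeDev, hφ_mean]
    congr 1
    ext x
    simp only [sub_zero, Set.mem_ofPred_eq, lt_iSup_iff, EReal.coe_lt_coe_iff, exists_prop]
    exact exists_congr fun k => and_congr_right fun hk => abs_birkhoffAverage_gt_iff (hn.trans hk)
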